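/- Let $n\in\mathbb{N}$ and $\mathcal N=\{1,\dots,n\}$. For $i,j\in\mathcal N$ let $a_{ij}:[0,\infty)\to[0,\infty)$ be measurable and integrable on bounded intervals. A trajectory is a function $x:[0,\infty)\to\mathbb{R}^n$ such that, for all $i\in\mathcal N$ and $t\ge 0$, the integral below exists and $$x_i(t)=x_i(0)+\int_0^t\sum_{j=1}^n a_{ij}(s)\,(x_j(s)-x_i(s))\,ds .$$ Suppose that there is a constant $M'$ with $a_{ij}(t)\le M'$ for all $i,j\in\mathcal N$ and $t\ge 0$, and that the weights satisfy pairwise reciprocity: there is $\varepsilon>0$ such that for every pair of distinct $i,j\in\mathcal N$ there is $T_{ij}>0$ such that, for every $t\ge0$ with $a_{ij}(t)>0$ or $a_{ji}(t)>0$, there is an interval $[\underline t,\overline t]\subset[0,\infty)$ containing $t$ with $$\overline t-\underline t\le T_{ij},\qquad \int_{\underline t}^{\overline t}a_{ij}(s)\,ds\ge\varepsilon,\qquad \int_{\underline t}^{\overline t}a_{ji}(s)\,ds\ge\varepsilon .$$ Then the following hold. 1. There is a sequence of times $0=t_0<t_1<t_2<\cdots$ with $t_p\to\infty$ and $\sup_p\,(t_{p+1}-t_p)<\infty$,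 for which there are constants $K\ge1$ and $M$ such that, for all $p\in\mathbb{N}$ and all non-empty proper subsets $S$ of $\mathcal N$ (integral reciprocity), $$\sum_{i\in S,\,j\notin S}\int_{t_p}^{t_{p+1}}a_{ij}(t)\,dt\;\le\;K\sum_{i\in S,\,j\notin S}\int_{t_p}^{t_{p+1}}a_{ji}(t)\,dt ,$$ and, for all $p\in\mathbb{N}$ and $i,j\in\mathcal N$ (integral bound), $\int_{t_p}^{t_{p+1}}a_{ij}(t)\,dt\le M$. 2. Let $G$ be the directed graph on $\mathcal N$ with an edge from $j$ to $i$ whenever $\int_0^\infty a_{ij}(t)\,dt=+\infty$. For all $i,j\in\mathcal N$ there is a directed path from $i$ to $j$ in $G$ if and only if there is a directed path from $j$ to $i$ in $G$. 3. Every trajectory $x$ converges: $\lim_{t\to\infty}x_i(t)$ exists in $\mathbb{R}$ for every $i\in\mathcal N$. Moreover $\lim_{t\to\infty}x_i(t)=\lim_{t\to\infty}x_j(t)$ whenever there is a directed path from $i$ to $j$ in $G$. -/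

import Mathlib

open Set Filter Topology MeasureTheory

/-- Interaction weights `a i j` of a system of `n` agents: functions of time `t ≥ 0` that are
non-negative, (Lebesgue) measurable, and summable on bounded intervals of `[0, ∞)`.
Their values at negative times play no role anywhere below. -/
structure IsWeightFamily {n : ℕ} (a : Fin n → Fin n → ℝ → ℝ) : Prop where
  nonneg : ∀ i j, ∀ t : ℝ, 0 ≤ t → 0 ≤ a i j t
  measurable : ∀ i j, AEMeasurable (a i j) (volume.restrict (Ici (0 : ℝ)))
  integrable : ∀ i j, ∀ t : ℝ, 0 ≤ t → IntegrableOn (a i j) (Icc 0 t) volume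

/-- `x` is a trajectory of the consensus system with weights `a`: for all `t ≥ 0`,
`x_i(t) = x_i(0) + ∫_0^t ∑_j a_ij(s) (x_j(s) - x_i(s)) ds`, the integrand being summable. -/
def IsTrajectory {n : ℕ} (a : Fin n → Fin n → ℝ → ℝ) (x : ℝ → Fin n → ℝ) : Prop :=
  ∀ i, ∀ t : ℝ, 0 ≤ t →
    IntervalIntegrable (fun s => ∑ j, a i j s * (x s j - x s i)) volume 0 t ∧
    x t i = x 0 i + ∫ s in (0 : ℝ)..t, ∑ j, a i j s * (x s j - x s i)

/-- Integral weight reciprocity along the sequence of times `τ`: `τ` is an increasing sequence in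
`[0, ∞)` that tends to infinity, and the weights are cut-balanced, with a uniform ratio `K ≥ 1`,
in integral over each interval `[τ p, τ (p + 1)]`. -/
def IntegralReciprocity {n : ℕ} (a : Fin n → Fin n → ℝ → ℝ) (τ : ℕ → ℝ) : Prop :=
  0 ≤ τ 0 ∧ StrictMono τ ∧ Tendsto τ atTop atTop ∧
    ∃ K : ℝ, 1 ≤ K ∧ ∀ S : Finset (Fin n), S.Nonempty → S ≠ Finset.univ → ∀ p : ℕ,
      ∑ i ∈ S, ∑ j ∈ Sᶜ, ∫ t in (τ p)..(τ (p + 1)), a i j t ≤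
        K * ∑ i ∈ S, ∑ j ∈ Sᶜ, ∫ t in (τ p)..(τ (p + 1)), a j i t

/-- Uniform upper bound on the integral weights along the sequence of times `τ`. -/
def IntegralBound {n : ℕ} (a : Fin n → Fin n → ℝ → ℝ) (τ : ℕ → ℝ) : Prop :=
  ∃ M : ℝ, ∀ i j, ∀ p : ℕ, ∫ t in (τ p)..(τ (p + 1)), a i j t ≤ M

/-- Pairwise reciprocity. The constant `ε` is common to all pairs, while the length `T` may depend
on the pair. The intervals lie in `[0, ∞)`, where the weights are defined. -/
def PairwiseReciprocity {n : ℕ} (a : Fin n → Fin n → ℝ → ℝ) : Prop :=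
  ∃ ε : ℝ, 0 < ε ∧ ∀ i j, i ≠ j → ∃ T : ℝ, 0 < T ∧
    ∀ t : ℝ, 0 ≤ t → (0 < a i j t ∨ 0 < a j i t) →
      ∃ l u : ℝ, 0 ≤ l ∧ u - l ≤ T ∧ t ∈ Icc l u ∧
        ε ≤ ∫ s in l..u, a i j s ∧ ε ≤ ∫ s in l..u, a j i s

/-- The directed graph of persistent weights: there is an edge from `j` to `i` if
`∫_0^∞ a_ij(t) dt = +∞`. -/
def persistentGraph {n : ℕ} (a : Fin n → Fin n → ℝ → ℝ) : Digraph (Fin n) where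
  Adj j i := ∫⁻ t in Ici (0 : ℝ), ENNReal.ofReal (a i j t) = ⊤

/-- There is a directed path from `i` to `j` in the graph of persistent weights. -/
def PersistentPath {n : ℕ} (a : Fin n → Fin n → ℝ → ℝ) (i j : Fin n) : Prop :=
  Relation.ReflTransGen (persistentGraph a).Adj i j

/-! The half-line can be cut into steps of bounded length on each of which a pair of distinct agents
either stays silent or has both integral weights at least `ε`. The obstacle is a cut that splits a
compensating interval. If a cut spoils a pair on one side, the interval around that pair's activity
near another nearby grid point cannot lie within the range tested at the first, so that each pair
and side excludes at most one grid point, and a pigeonhole argument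
(`CompensatedWithin.exists_safe`) leaves an admissible cut. Bounded weights then give integral
reciprocity and the integral bound.

On such a partition the integral of a weight between distinct agents diverges exactly when the pair
is active on infinitely many steps, which is a symmetric condition. The persistent graph is
therefore symmetric, and each of its components is eventually isolated
(`IsBalancedPartition.exists_isRecurrentClass`).

Within a component the minimum eventually increases and the maximum decreases. A set of agents lying
above the minimum loses nothing of its guaranteed excess while it does not interact with the rest,
however long this lasts; when it does interact, a new agent receives a fixed fraction of the excess
(`IsTrajectory.transmission_mul_le`). After finitely many such events the minimum has risen by a
fixed fraction of the gap between maximum and minimum, so the limit of the gap must be zero. -/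

/-! ### Cutting time so that every pair is silent or reciprocal on each step. -/

section Partition

variable {n : ℕ} {a : Fin n → Fin n → ℝ → ℝ}

theorem IsWeightFamily.intervalIntegrable (ha : IsWeightFamily a) (i j : Fin n) {s u : ℝ}
    (hs : 0 ≤ s) (hu : 0 ≤ u) : IntervalIntegrable (a i j) volume s u := by
  have key : ∀ t, 0 ≤ t → IntervalIntegrable (a i j) volume 0 t := fun t ht =>
    (intervalIntegrable_iff_integrableOn_Icc_of_le ht).2 (ha.integrable i j t ht)
  exact (key s hs).symm.trans (key u hu)

theorem IsWeightFamily.integral_mono_interval (ha : IsWeightFamily a) (i j : Fin n)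
    {s l u v : ℝ} (hs : 0 ≤ s) (hsl : s ≤ l) (hlu : l ≤ u) (huv : u ≤ v) :
    ∫ t in l..u, a i j t ≤ ∫ t in s..v, a i j t := by
  refine intervalIntegral.integral_mono_interval hsl hlu huv ?_
    (ha.intervalIntegrable i j hs (by linarith))
  filter_upwards [ae_restrict_mem measurableSet_Ioc] with t ht
  exact ha.nonneg i j t (hs.trans ht.1.le)

/-- The pair `{i, j}` interacts at time `t`, in at least one direction. -/
def ActiveAt (a : Fin n → Fin n → ℝ → ℝ) (i j : Fin n) (t : ℝ) : Prop :=
  0 < a i j t ∨ 0 < a j i t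

/-- Both integral weights of the pair `{i, j}` over `[l, u]` are at least `ε`. -/
def ReciprocalOn (a : Fin n → Fin n → ℝ → ℝ) (ε : ℝ) (i j : Fin n) (l u : ℝ) : Prop :=
  ε ≤ ∫ s in l..u, a i j s ∧ ε ≤ ∫ s in l..u, a j i s

theorem ReciprocalOn.mono {ε : ℝ} {i j : Fin n} {s l u v : ℝ} (h : ReciprocalOn a ε i j l u)
    (ha : IsWeightFamily a) (hs : 0 ≤ s) (hsl : s ≤ l) (hlu : l ≤ u) (huv : u ≤ v) :
    ReciprocalOn a ε i j s v :=
  ⟨h.1.trans (ha.integral_mono_interval i j hs hsl hlu huv),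
    h.2.trans (ha.integral_mono_interval j i hs hsl hlu huv)⟩

/-- Activity of any pair is compensated, up to the level `ε`, over an interval of length at
most `T` containing the activity. -/
def CompensatedWithin (a : Fin n → Fin n → ℝ → ℝ) (ε T : ℝ) : Prop :=
  ∀ i j, i ≠ j → ∀ t : ℝ, 0 ≤ t → ActiveAt a i j t →
    ∃ l u : ℝ, 0 ≤ l ∧ u - l ≤ T ∧ t ∈ Icc l u ∧ ReciprocalOn a ε i j l u

theorem PairwiseReciprocity.exists_compensatedWithin (h : PairwiseReciprocity a) :
    ∃ ε T : ℝ, 0 < ε ∧ 0 < T ∧ CompensatedWithin a ε T := by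
  obtain ⟨ε, hε, h⟩ := h
  have h' : ∀ q : Fin n × Fin n, ∃ T : ℝ, q.1 ≠ q.2 → ∀ t : ℝ, 0 ≤ t → ActiveAt a q.1 q.2 t →
      ∃ l u : ℝ, 0 ≤ l ∧ u - l ≤ T ∧ t ∈ Icc l u ∧ ReciprocalOn a ε q.1 q.2 l u := by
    intro q
    by_cases hq : q.1 = q.2
    · exact ⟨0, fun h => absurd hq h⟩
    · obtain ⟨T, -, hT⟩ := h q.1 q.2 hq
      exact ⟨T, fun _ => hT⟩
  choose T hT using h'
  obtain ⟨B, hB⟩ := Finite.exists_le T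
  refine ⟨ε, max B 1, hε, lt_max_of_lt_right one_pos, fun i j hij t ht hact => ?_⟩
  obtain ⟨l, u, hl, hlu, hmem, hr⟩ := hT (i, j) hij t ht hact
  exact ⟨l, u, hl, (hlu.trans (hB _)).trans (le_max_left _ _), hmem, hr⟩

/-- Activity of `{i, j}` right after `t` is compensated soon after `t`. -/
def SafeRight (a : Fin n → Fin n → ℝ → ℝ) (ε T R : ℝ) (i j : Fin n) (t : ℝ) : Prop :=
  (∃ r ∈ Icc t (t + T), ActiveAt a i j r) → ReciprocalOn a ε i j t (t + R)

/-- Activity of `{i, j}` right before `t` is compensated shortly before `t`. -/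
def SafeLeft (a : Fin n → Fin n → ℝ → ℝ) (ε T R : ℝ) (i j : Fin n) (t : ℝ) : Prop :=
  (∃ r ∈ Icc (t - T) t, ActiveAt a i j r) → ReciprocalOn a ε i j (t - R) t

/-- Activity in `[t, t + T]` is compensated inside `[t - T, t + 2 * T]`, which lies in `[s, s + R]`;
that would make `s` safe. So a failure on the right protects later grid points. -/
theorem CompensatedWithin.safeRight_of_not_safeRight {ε T R : ℝ} (hc : CompensatedWithin a ε T)
    (ha : IsWeightFamily a) {i j : Fin n} (hij : i ≠ j) {s t : ℝ} (hs : 0 ≤ s)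
    (hst : s + T ≤ t) (hts : t + T ≤ s + R - T) (hT : 0 < T)
    (h : ¬ SafeRight a ε T R i j s) : SafeRight a ε T R i j t := by
  rintro ⟨r, hr, hact⟩
  obtain ⟨l, u, -, hlu, hmem, hrec⟩ := hc i j hij r (by linarith [hr.1, hs]) hact
  refine absurd (fun _ => ?_) h
  exact hrec.mono ha hs (by linarith [hr.1, hmem.2]) (hmem.1.trans hmem.2)
    (by linarith [hr.2, hmem.1])

/-- The mirror image: a failure on the left protects earlier grid points. The condition `R ≤ s`
keeps `[t - R, t]` inside `[0, ∞)`. -/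
theorem CompensatedWithin.safeLeft_of_not_safeLeft {ε T R : ℝ} (hc : CompensatedWithin a ε T)
    (ha : IsWeightFamily a) {i j : Fin n} (hij : i ≠ j) {s t : ℝ} (hR : R ≤ s)
    (hst : s + T ≤ t) (hts : t + T ≤ s + R - T) (hT : 0 < T)
    (h : ¬ SafeLeft a ε T R i j t) : SafeLeft a ε T R i j s := by
  rintro ⟨r, hr, hact⟩
  obtain ⟨l, u, -, hlu, hmem, hrec⟩ := hc i j hij r (by linarith [hr.1]) hact
  refine absurd (fun _ => ?_) h
  exact hrec.mono ha (by linarith) (by linarith [hr.1, hmem.2]) (hmem.1.trans hmem.2)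
    (by linarith [hr.2, hmem.1])

/-- Every long enough window contains a time that is safe on both sides for all pairs: each pair
and side rules out at most one point of a grid with step `T`. -/
theorem CompensatedWithin.exists_safe {ε T R N : ℝ} (hc : CompensatedWithin a ε T)
    (ha : IsWeightFamily a) (hT : 0 < T)
    (hN : N = (Fintype.card (Bool × Fin n × Fin n) : ℝ)) (hR : R = (N + 2) * T)
    {A : ℝ} (hA : R ≤ A) :
    ∃ t ∈ Icc A (A + N * T), ∀ i j, i ≠ j →
      SafeRight a ε T R i j t ∧ SafeLeft a ε T R i j t := by
  by_contra! hcon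
  have hN0 : 0 ≤ N := hN ▸ Nat.cast_nonneg _
  -- Label each of the `N + 1` grid points by a pair and a side that fail there; only `N` labels
  -- exist. The width `R = (N + 2) * T` covers the whole grid plus the margin `2 * T` needed for
  -- compensation.
  have hcon' : ∀ k : Fin (Fintype.card (Bool × Fin n × Fin n) + 1),
      ∃ q : Bool × Fin n × Fin n, q.2.1 ≠ q.2.2 ∧
        (q.1 = true → ¬ SafeRight a ε T R q.2.1 q.2.2 (A + k * T)) ∧
        (q.1 = false → ¬ SafeLeft a ε T R q.2.1 q.2.2 (A + k * T)) := by
    intro k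
    have hk : ((k : ℕ) : ℝ) ≤ N := by
      rw [hN]; exact_mod_cast Nat.lt_succ_iff.1 k.2
    obtain ⟨i, j, hij, h⟩ := hcon (A + k * T)
      ⟨le_add_of_nonneg_right (by positivity), by gcongr⟩
    by_cases hr : SafeRight a ε T R i j (A + k * T)
    · exact ⟨(false, i, j), hij, by simp, fun _ => h hr⟩
    · exact ⟨(true, i, j), hij, fun _ => hr, by simp⟩
  choose f hf hfR hfL using hcon'
  obtain ⟨k, m, hne, hkm⟩ := Fintype.exists_ne_map_eq_of_card_lt f (by simp)
  wlog hlt : k < m generalizing k m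
  · exact this m k hne.symm hkm.symm (lt_of_le_of_ne (not_lt.1 hlt) hne.symm)
  have h1 : ((k : ℕ) : ℝ) + 1 ≤ (m : ℕ) := by exact_mod_cast hlt
  have hm : ((m : ℕ) : ℝ) ≤ N := by
    rw [hN]; exact_mod_cast Nat.lt_succ_iff.1 m.2
  have hk0 : (0 : ℝ) ≤ ((k : ℕ) : ℝ) := Nat.cast_nonneg _
  have e1 : (((k : ℕ) : ℝ) + 1) * T ≤ (m : ℕ) * T := by gcongr
  have e2 : ((m : ℕ) : ℝ) * T ≤ N * T := by gcongr
  have e3 : 0 ≤ ((k : ℕ) : ℝ) * T := by positivity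
  have e4 : 0 ≤ N * T := by positivity
  -- Of two points with the same label, a right failure at `k` makes `m` safe, and a left failure at
  -- `m` makes `k` safe.
  cases hb : (f k).1 with
  | true =>
    refine hfR m (hkm ▸ hb) ?_
    rw [← hkm]
    exact hc.safeRight_of_not_safeRight ha (hf k) (by nlinarith) (by linarith) (by linarith) hT
      (hfR k hb)
  | false =>
    refine hfL k hb ?_
    refine hc.safeLeft_of_not_safeLeft ha (hf k) (t := A + m * T) (by linarith) (by linarith)
      (by linarith) hT ?_
    have := hfL m (hkm ▸ hb)
    rwa [← hkm] at this

/-- Along `τ`, on each interval `[τ p, τ (p + 1)]` a pair either does not interact or has both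
integral weights at least `ε`. -/
structure IsBalancedPartition (a : Fin n → Fin n → ℝ → ℝ) (ε B : ℝ) (τ : ℕ → ℝ) : Prop where
  zero : τ 0 = 0
  strictMono : StrictMono τ
  tendsto : Tendsto τ atTop atTop
  step_le : ∀ p, τ (p + 1) - τ p ≤ B
  dichotomy : ∀ i j, i ≠ j → ∀ p, (∃ t ∈ Icc (τ p) (τ (p + 1)), ActiveAt a i j t) →
    ReciprocalOn a ε i j (τ p) (τ (p + 1))

theorem IsBalancedPartition.nonneg {ε B : ℝ} {τ : ℕ → ℝ} (h : IsBalancedPartition a ε B τ)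
    (p : ℕ) : 0 ≤ τ p := h.zero ▸ h.strictMono.monotone (Nat.zero_le p)

theorem IsBalancedPartition.le_succ {ε B : ℝ} {τ : ℕ → ℝ} (h : IsBalancedPartition a ε B τ)
    (p : ℕ) : τ p ≤ τ (p + 1) := h.strictMono.monotone (Nat.le_succ p)

theorem CompensatedWithin.exists_isBalancedPartition {ε T : ℝ} (hc : CompensatedWithin a ε T)
    (ha : IsWeightFamily a) (hT : 0 < T) :
    ∃ B : ℝ, ∃ τ : ℕ → ℝ, IsBalancedPartition a ε B τ := by
  obtain ⟨N, hN⟩ : ∃ N : ℝ, N = (Fintype.card (Bool × Fin n × Fin n) : ℝ) := ⟨_, rfl⟩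
  obtain ⟨R, hR⟩ : ∃ R : ℝ, R = (N + 2) * T := ⟨_, rfl⟩
  have hN0 : 0 ≤ N := hN ▸ Nat.cast_nonneg _
  have hNT : 0 ≤ N * T := by positivity
  have hRT : 2 * T ≤ R := by nlinarith
  -- The condition `0 ≤ s` sits inside the existential so that `choose` yields a total map to
  -- iterate; the value at negative `s` is irrelevant.
  have hstep : ∀ s : ℝ, ∃ t, 0 ≤ s → t ∈ Icc (s + R) (s + R + N * T) ∧ ∀ i j, i ≠ j →
      SafeRight a ε T R i j t ∧ SafeLeft a ε T R i j t := by
    intro s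
    by_cases hs : 0 ≤ s
    · obtain ⟨t, ht, h⟩ := hc.exists_safe ha hT hN hR (A := s + R) (by linarith)
      exact ⟨t, fun _ => ⟨ht, h⟩⟩
    · exact ⟨0, fun h => absurd h hs⟩
  choose g hg using hstep
  let τ : ℕ → ℝ := fun p => g^[p] 0
  have hsucc : ∀ p, τ (p + 1) = g (τ p) := fun p => Function.iterate_succ_apply' g p 0
  have hnn : ∀ p, 0 ≤ τ p := by
    intro p
    induction p with
    | zero => exact le_rfl
    | succ p ih => rw [hsucc]; linarith [(hg _ ih).1.1]
  have hlow : ∀ p, τ p + R ≤ τ (p + 1) := fun p => hsucc p ▸ (hg _ (hnn p)).1.1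
  have hR0 : 0 < R := by linarith
  have hright : ∀ p i j, i ≠ j → SafeRight a ε T R i j (τ p) := by
    intro p i j hij
    cases p with
    -- Time `0` is safe on the right because compensating intervals lie in `[0, ∞)`; safety on the
    -- left is never needed there.
    | zero =>
      rintro ⟨r, hr, hact⟩
      change r ∈ Icc (0 : ℝ) (0 + T) at hr
      change ReciprocalOn a ε i j 0 (0 + R)
      obtain ⟨l, u, hl, hlu, hmem, hrec⟩ := hc i j hij r hr.1 hact
      exact hrec.mono ha le_rfl hl (hmem.1.trans hmem.2) (by linarith [hmem.1, hr.2])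
    | succ p => rw [hsucc]; exact ((hg _ (hnn p)).2 i j hij).1
  refine ⟨R + N * T, τ, rfl, strictMono_nat_of_lt_succ fun p => by linarith [hlow p], ?_,
    fun p => by linarith [hsucc p, (hg _ (hnn p)).1.2], ?_⟩
  · have hlin : ∀ p : ℕ, (p : ℝ) * R ≤ τ p := by
      intro p
      induction p with
      | zero => simp [τ]
      | succ p ih => push_cast; linarith [hlow p]
    exact tendsto_atTop_mono hlin (tendsto_natCast_atTop_atTop.atTop_mul_const hR0)
  · rintro i j hij p ⟨r, hr, hact⟩
    obtain ⟨l, u, hl, hlu, hmem, hrec⟩ := hc i j hij r ((hnn p).trans hr.1) hact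
    -- If the compensating interval crosses an endpoint of the step, the activity is within `T` of
    -- that endpoint, whose safety supplies compensation inside the step, of length at least `R`.
    by_cases h1 : τ p ≤ l
    · by_cases h2 : u ≤ τ (p + 1)
      · exact hrec.mono ha (hnn p) h1 (hmem.1.trans hmem.2) h2
      · have hsafe : SafeLeft a ε T R i j (τ (p + 1)) := by
          rw [hsucc]; exact ((hg _ (hnn p)).2 i j hij).2
        exact (hsafe ⟨r, ⟨by linarith [hmem.1], hr.2⟩, hact⟩).mono ha (hnn p)
          (by linarith [hlow p]) (by linarith) le_rfl
    · exact (hright p i j hij ⟨r, ⟨hr.1, by linarith [hmem.2]⟩, hact⟩).mono ha (hnn p)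
        le_rfl (by linarith) (hlow p)

namespace IsBalancedPartition

variable {ε B M' : ℝ} {τ : ℕ → ℝ}

theorem integral_le (h : IsBalancedPartition a ε B τ) (ha : IsWeightFamily a)
    (hbound : ∀ i j, ∀ t : ℝ, 0 ≤ t → a i j t ≤ M') (i j : Fin n) (p : ℕ) :
    ∫ t in (τ p)..(τ (p + 1)), a i j t ≤ M' * B := by
  have hM : 0 ≤ M' := (ha.nonneg i j 0 le_rfl).trans (hbound i j 0 le_rfl)
  calc ∫ t in (τ p)..(τ (p + 1)), a i j t ≤ ∫ _ in (τ p)..(τ (p + 1)), M' := by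
        refine intervalIntegral.integral_mono_on (h.le_succ p)
          (ha.intervalIntegrable i j (h.nonneg p) (h.nonneg _)) intervalIntegrable_const ?_
        exact fun t ht => hbound i j t ((h.nonneg p).trans ht.1)
    _ = (τ (p + 1) - τ p) * M' := by simp
    _ ≤ M' * B := by rw [mul_comm]; exact mul_le_mul_of_nonneg_left (h.step_le p) hM

theorem eq_zero_of_not_active (h : IsBalancedPartition a ε B τ) (ha : IsWeightFamily a)
    {i j : Fin n} {p : ℕ} (hn : ¬ ∃ t ∈ Icc (τ p) (τ (p + 1)), ActiveAt a i j t)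
    {t : ℝ} (ht : t ∈ Icc (τ p) (τ (p + 1))) : a i j t = 0 :=
  le_antisymm (not_lt.1 fun hpos => hn ⟨t, ht, Or.inl hpos⟩)
    (ha.nonneg i j t ((h.nonneg p).trans ht.1))

theorem integralBound (h : IsBalancedPartition a ε B τ) (ha : IsWeightFamily a)
    (hbound : ∀ i j, ∀ t : ℝ, 0 ≤ t → a i j t ≤ M') : IntegralBound a τ :=
  ⟨M' * B, fun i j p => h.integral_le ha hbound i j p⟩

/-- Cut balance holds pair by pair: the two integrals of a silent pair vanish, and those of an
active pair lie in `[ε, M' * B]`. -/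
theorem integralReciprocity (h : IsBalancedPartition a ε B τ) (ha : IsWeightFamily a)
    (hε : 0 < ε) (hbound : ∀ i j, ∀ t : ℝ, 0 ≤ t → a i j t ≤ M') :
    IntegralReciprocity a τ := by
  refine ⟨h.zero.ge, h.strictMono, h.tendsto, max 1 (M' * B / ε), le_max_left _ _, ?_⟩
  intro S _ _ p
  simp_rw [Finset.mul_sum]
  refine Finset.sum_le_sum fun i hi => Finset.sum_le_sum fun j hj => ?_
  have hij : i ≠ j := fun e => Finset.mem_compl.1 hj (e ▸ hi)
  by_cases hact : ∃ t ∈ Icc (τ p) (τ (p + 1)), ActiveAt a i j t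
  · calc ∫ t in (τ p)..(τ (p + 1)), a i j t ≤ M' * B := h.integral_le ha hbound i j p
      _ = M' * B / ε * ε := by field_simp
      _ ≤ max 1 (M' * B / ε) * ε := by gcongr; exact le_max_right _ _
      _ ≤ _ := by gcongr; exact (h.dichotomy i j hij p hact).2
  · have h0 : ∫ t in (τ p)..(τ (p + 1)), a i j t = 0 := by
      rw [intervalIntegral.integral_congr (g := fun _ => (0 : ℝ)), intervalIntegral.integral_zero]
      intro t ht
      rw [uIcc_of_le (h.le_succ p)] at ht
      exact h.eq_zero_of_not_active ha hact ht
    rw [h0]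
    refine mul_nonneg (zero_le_one.trans (le_max_left _ _))
      (intervalIntegral.integral_nonneg (h.le_succ p) fun t ht => ?_)
    exact ha.nonneg j i t ((h.nonneg p).trans ht.1)

end IsBalancedPartition

end Partition

/-! ### Persistent edges as recurrent activity; symmetry of the graph. -/

section Persistence

variable {n : ℕ} {a : Fin n → Fin n → ℝ → ℝ} {ε B : ℝ} {τ : ℕ → ℝ}

/-- The pair `{i, j}` interacts at some time of the interval `[τ p, τ (p + 1)]`. -/
def ActiveOnStep (a : Fin n → Fin n → ℝ → ℝ) (τ : ℕ → ℝ) (i j : Fin n) (p : ℕ) : Prop :=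
  ∃ t ∈ Icc (τ p) (τ (p + 1)), ActiveAt a i j t

theorem ActiveOnStep.symm {i j : Fin n} {p : ℕ} (h : ActiveOnStep a τ i j p) :
    ActiveOnStep a τ j i p :=
  let ⟨t, ht, h⟩ := h
  ⟨t, ht, Or.symm h⟩

namespace IsBalancedPartition

theorem exists_mem_Icc (h : IsBalancedPartition a ε B τ) {P : ℕ} {t : ℝ} (ht : τ P ≤ t) :
    ∃ p, P ≤ p ∧ t ∈ Icc (τ p) (τ (p + 1)) := by
  have key : ∀ q, t ≤ τ (P + q + 1) → ∃ p, P ≤ p ∧ t ∈ Icc (τ p) (τ (p + 1)) := by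
    intro q
    induction q with
    | zero => exact fun hq => ⟨P, le_rfl, ht, hq⟩
    | succ q ih =>
      intro hq
      by_cases hle : t ≤ τ (P + q + 1)
      · exact ih hle
      · exact ⟨P + q + 1, by omega, (not_le.1 hle).le, hq⟩
  obtain ⟨q, hq⟩ := (h.tendsto.eventually (eventually_ge_atTop t)).exists
  exact key q (hq.trans (h.strictMono.monotone (by omega)))

theorem eq_zero_of_forall_not_active (h : IsBalancedPartition a ε B τ) (ha : IsWeightFamily a)
    {i j : Fin n} {P : ℕ} (hn : ∀ p, P ≤ p → ¬ ActiveOnStep a τ i j p) {t : ℝ} (ht : τ P ≤ t) :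
    a i j t = 0 := by
  obtain ⟨p, hp, hmem⟩ := h.exists_mem_Icc ht
  exact h.eq_zero_of_not_active ha (hn p hp) hmem

/-- A pair that falls silent for good has only its integral over a bounded interval left, which is
finite. -/
theorem frequently_active_of_persistent (h : IsBalancedPartition a ε B τ) (ha : IsWeightFamily a)
    {i j : Fin n} (hij : (persistentGraph a).Adj j i) :
    ∃ᶠ p in atTop, ActiveOnStep a τ i j p := by
  intro hev
  obtain ⟨P, hP⟩ := eventually_atTop.1 hev
  have hzero : ∀ t, τ P ≤ t → a i j t = 0 := fun t ht => h.eq_zero_of_forall_not_active ha hP ht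
  have h1 : ∫⁻ t in Icc 0 (τ P), ENNReal.ofReal (a i j t) < ⊤ :=
    (ha.integrable i j (τ P) (h.nonneg P)).lintegral_lt_top
  have h2 : ∫⁻ t in Ici (τ P), ENNReal.ofReal (a i j t) = 0 := by
    rw [setLIntegral_congr_fun measurableSet_Ici (g := fun _ => 0)]
    · simp
    · intro t ht
      simp [hzero t ht]
  have h3 : ∫⁻ t in Ici (0 : ℝ), ENNReal.ofReal (a i j t) ≤
      (∫⁻ t in Icc 0 (τ P), ENNReal.ofReal (a i j t)) +
        ∫⁻ t in Ici (τ P), ENNReal.ofReal (a i j t) := by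
    rw [← Icc_union_Ici_eq_Ici (h.nonneg P)]
    exact lintegral_union_le _ _ _
  rw [h2, add_zero, show ∫⁻ t in Ici (0 : ℝ), ENNReal.ofReal (a i j t) = ⊤ from hij] at h3
  exact absurd h3 (not_le.2 h1)

/-- Infinitely many steps contribute at least `ε` each, so the series of step integrals cannot
converge. -/
theorem persistent_of_frequently_active (h : IsBalancedPartition a ε B τ) (ha : IsWeightFamily a)
    (hε : 0 < ε) {i j : Fin n} (hij : i ≠ j) (hf : ∃ᶠ p in atTop, ActiveOnStep a τ i j p) :
    (persistentGraph a).Adj j i := by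
  change ∫⁻ t in Ici (0 : ℝ), ENNReal.ofReal (a i j t) = ⊤
  have hsum : ∑' p, ∫⁻ t in Ioc (τ p) (τ (p + 1)), ENNReal.ofReal (a i j t) = ⊤ := by
    by_contra hne
    have hlim := ENNReal.tendsto_atTop_zero_of_tsum_ne_top hne
    have hev := hlim.eventually (gt_mem_nhds (ENNReal.ofReal_pos.2 hε))
    obtain ⟨p, hact, hlt⟩ := (hf.and_eventually hev).exists
    refine absurd hlt (not_lt.2 ?_)
    have hint := (intervalIntegrable_iff_integrableOn_Ioc_of_le (h.le_succ p)).1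
      (ha.intervalIntegrable i j (h.nonneg p) (h.nonneg (p + 1)))
    rw [← ofReal_integral_eq_lintegral_ofReal hint, ← intervalIntegral.integral_of_le (h.le_succ p)]
    · exact ENNReal.ofReal_le_ofReal (h.dichotomy i j hij p hact).1
    · filter_upwards [ae_restrict_mem measurableSet_Ioc] with t ht
      exact ha.nonneg i j t ((h.nonneg p).trans ht.1.le)
  rw [← top_le_iff, ← hsum, ← lintegral_iUnion (fun _ => measurableSet_Ioc)]
  · refine lintegral_mono_set (iUnion_subset fun p t ht => ?_)
    exact (h.nonneg p).trans ht.1.le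
  · exact h.strictMono.monotone.pairwise_disjoint_on_Ioc_succ

theorem persistentGraph_symm (h : IsBalancedPartition a ε B τ) (ha : IsWeightFamily a)
    (hε : 0 < ε) {i j : Fin n} (hij : (persistentGraph a).Adj i j) :
    (persistentGraph a).Adj j i := by
  rcases eq_or_ne i j with rfl | hne
  · exact hij
  · exact h.persistent_of_frequently_active ha hε hne
      ((h.frequently_active_of_persistent ha hij).mono fun _ hp => hp.symm)

theorem persistentPath_symm (h : IsBalancedPartition a ε B τ) (ha : IsWeightFamily a)
    (hε : 0 < ε) {i j : Fin n} (hij : PersistentPath a i j) : PersistentPath a j i :=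
  haveI : Std.Symm (persistentGraph a).Adj := ⟨fun _ _ e => h.persistentGraph_symm ha hε e⟩
  Std.Symm.symm (r := Relation.ReflTransGen (persistentGraph a).Adj) _ _ hij

end IsBalancedPartition

end Persistence

/-! ### Maximum principle, exponential retention and transmission of excess. -/

section Trajectory

variable {n : ℕ} {a : Fin n → Fin n → ℝ → ℝ} {x : ℝ → Fin n → ℝ} {M' : ℝ}

theorem IsTrajectory.neg (hx : IsTrajectory a x) : IsTrajectory a (-x) := by
  intro i t ht
  have e : (fun s => ∑ j, a i j s * ((-x) s j - (-x) s i)) =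
      fun s => -∑ j, a i j s * (x s j - x s i) := by
    funext s
    rw [← Finset.sum_neg_distrib]
    exact Finset.sum_congr rfl fun j _ => by simp only [Pi.neg_apply]; ring
  rw [e]
  refine ⟨(hx i t ht).1.neg, ?_⟩
  rw [intervalIntegral.integral_neg]
  simp only [Pi.neg_apply]
  linarith [(hx i t ht).2]

theorem IsTrajectory.intervalIntegrable (hx : IsTrajectory a x) (i : Fin n) {s u : ℝ}
    (hs : 0 ≤ s) (hu : 0 ≤ u) :
    IntervalIntegrable (fun r => ∑ j, a i j r * (x r j - x r i)) volume s u :=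
  (hx i s hs).1.symm.trans (hx i u hu).1

theorem IsTrajectory.sub_eq_integral (hx : IsTrajectory a x) (i : Fin n) {s u : ℝ}
    (hs : 0 ≤ s) (hu : 0 ≤ u) :
    x u i - x s i = ∫ r in s..u, ∑ j, a i j r * (x r j - x r i) := by
  rw [← intervalIntegral.integral_interval_sub_left (hx i u hu).1 (hx i s hs).1,
    (hx i u hu).2, (hx i s hs).2]
  ring

theorem IsTrajectory.continuousOn (hx : IsTrajectory a x) (i : Fin n) {s u : ℝ} (hs : 0 ≤ s) :
    ContinuousOn (fun t => x t i) (Icc s u) := by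
  rcases lt_or_ge u s with hus | hsu
  · simp [Icc_eq_empty (not_le.2 hus)]
  have hu : 0 ≤ u := hs.trans hsu
  have hc : ContinuousOn
      (fun t => x 0 i + ∫ r in (0 : ℝ)..t, ∑ j, a i j r * (x r j - x r i)) (Icc 0 u) := by
    have := intervalIntegral.continuousOn_primitive_interval (μ := volume)
      (f := fun r => ∑ j, a i j r * (x r j - x r i)) (a := 0) (b := u)
      (by rw [uIcc_of_le hu]
          exact (intervalIntegrable_iff_integrableOn_Icc_of_le hu).1 (hx i u hu).1)
    rw [uIcc_of_le hu] at this
    exact continuousOn_const.add this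
  exact (hc.congr fun t ht => (hx i t ht.1).2).mono (Icc_subset_Icc_left hs)

theorem IsTrajectory.integral_le_sub (hx : IsTrajectory a x) {i : Fin n} {s u : ℝ} (hs : 0 ≤ s)
    (hsu : s ≤ u) {f : ℝ → ℝ} (hf : IntervalIntegrable f volume s u)
    (hle : ∀ r ∈ Icc s u, f r ≤ ∑ j, a i j r * (x r j - x r i)) :
    ∫ r in s..u, f r ≤ x u i - x s i := by
  rw [hx.sub_eq_integral i hs (hs.trans hsu)]
  exact intervalIntegral.integral_mono_on hsu hf
    (hx.intervalIntegrable i hs (hs.trans hsu)) hle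

/-- No agent of `C` is influenced from outside `C` during `[s, u]`. -/
def IsolatedOn (a : Fin n → Fin n → ℝ → ℝ) (C : Finset (Fin n)) (s u : ℝ) : Prop :=
  ∀ i ∈ C, ∀ j ∉ C, ∀ r ∈ Icc s u, a i j r = 0

theorem IsolatedOn.mono {C : Finset (Fin n)} {s u s' u' : ℝ} (h : IsolatedOn a C s u)
    (hs : s ≤ s') (hu : u' ≤ u) : IsolatedOn a C s' u' :=
  fun i hi j hj r hr => h i hi j hj r ⟨hs.trans hr.1, hr.2.trans hu⟩

/-- Maximum principle on an isolated set of agents. -/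
theorem IsTrajectory.le_of_isolatedOn (hx : IsTrajectory a x) (ha : IsWeightFamily a)
    (hbound : ∀ i j, ∀ t : ℝ, 0 ≤ t → a i j t ≤ M') {C : Finset (Fin n)} {s u m : ℝ}
    (hs : 0 ≤ s) (hC : IsolatedOn a C s u) (hm : ∀ i ∈ C, x s i ≤ m) {t : ℝ}
    (ht : t ∈ Icc s u) {i : Fin n} (hi : i ∈ C) : x t i ≤ m := by
  have hne : C.Nonempty := ⟨i, hi⟩
  have hM : 0 ≤ M' := (ha.nonneg i i 0 le_rfl).trans (hbound i i 0 le_rfl)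
  let f : ℝ → ℝ := fun t => C.sup' hne fun k => x t k
  have hfc : ContinuousOn f (Icc s u) :=
    ContinuousOn.finset_sup'_apply hne fun k _ => hx.continuousOn k hs
  have hslope : ∀ r ∈ Ico s u, ∀ η : ℝ, (0 : ℝ) < η →
      ∃ᶠ z in 𝓝[>] r, (z - r)⁻¹ * (f z - f r) < η := by
    intro r hr η hη
    -- This `η'` makes the growth rate `n * M' * (2 * η')` at most `η / 2`.
    obtain ⟨η', hη', hη'K⟩ : ∃ η' > 0, n * M' * (2 * η') < η := by
      refine ⟨η / (4 * (n * M' + 1)), by positivity, ?_⟩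
      rw [← sub_pos]
      have : η - n * M' * (2 * (η / (4 * (n * M' + 1)))) =
          η * (n * M' / 2 + 1) / (n * M' + 1) := by field_simp; ring
      rw [this]; positivity
    -- Just after `r`, agents below the maximum remain below its value at `r`. An agent attaining it
    -- is exceeded by members of `C` by at most `2 * η'`, so it rises slowly. No derivative of `x`
    -- is needed.
    have hev : ∀ᶠ z in 𝓝[≥] r, z < u ∧ ∀ k ∈ C, |x z k - x r k| < η' ∧
        (x r k < f r → x z k < f r) := by
      refine ((eventually_lt_nhds hr.2).filter_mono nhdsWithin_le_nhds).and ?_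
      refine (Finset.eventually_all C).2 fun k _ => ?_
      have hck : Tendsto (fun t => x t k) (𝓝[≥] r) (𝓝 (x r k)) :=
        ((hx.continuousOn k hs r ⟨hr.1, hr.2.le⟩).mono_of_mem_nhdsWithin
          (mem_of_superset (Icc_mem_nhdsGE hr.2) (Icc_subset_Icc_left hr.1)))
      refine (hck.eventually (Metric.ball_mem_nhds _ hη')).and ?_
      by_cases hlt : x r k < f r
      · exact (hck.eventually (gt_mem_nhds hlt)).mono fun _ h _ => h
      · exact Eventually.of_forall fun _ h => absurd h hlt
    obtain ⟨b, hb, hsub⟩ := (mem_nhdsGE_iff_exists_Icc_subset).1 hev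
    refine Eventually.frequently ?_
    filter_upwards [Ioo_mem_nhdsGT (show r < b from hb)] with z hz
    have hzr : 0 < z - r := sub_pos.2 hz.1
    have hzu : z < u := (hsub ⟨hz.1.le, hz.2.le⟩).1
    have hfz : f z ≤ f r + n * M' * (2 * η') * (z - r) := by
      refine Finset.sup'_le hne _ fun k hk => ?_
      have hkr : x r k ≤ f r := Finset.le_sup' (fun k => x r k) hk
      rcases hkr.lt_or_eq with hlt | heq
      · have := ((hsub ⟨hz.1.le, hz.2.le⟩).2 k hk).2 hlt
        have : 0 ≤ n * M' * (2 * η') * (z - r) := by positivity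
        linarith
      · have hint : x z k - x r k ≤ ∫ _ in r..z, n * M' * (2 * η') := by
          rw [hx.sub_eq_integral k (hs.trans hr.1) (hs.trans (hr.1.trans hz.1.le))]
          refine intervalIntegral.integral_mono_on hz.1.le
            (hx.intervalIntegrable k (hs.trans hr.1) (hs.trans (hr.1.trans hz.1.le)))
            intervalIntegrable_const fun w hw => ?_
          have hw0 : 0 ≤ w := hs.trans (hr.1.trans hw.1)
          have hwk := abs_lt.1 ((hsub ⟨hw.1, hw.2.trans hz.2.le⟩).2 k hk).1
          calc ∑ j, a k j w * (x w j - x w k) ≤ ∑ _j : Fin n, M' * (2 * η') := by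
                refine Finset.sum_le_sum fun j _ => ?_
                by_cases hj : j ∈ C
                · have hwj := abs_lt.1 ((hsub ⟨hw.1, hw.2.trans hz.2.le⟩).2 j hj).1
                  have hjr : x r j ≤ f r := Finset.le_sup' (fun k => x r k) hj
                  calc a k j w * (x w j - x w k) ≤ a k j w * (2 * η') :=
                        mul_le_mul_of_nonneg_left (by linarith) (ha.nonneg k j w hw0)
                    _ ≤ M' * (2 * η') :=
                        mul_le_mul_of_nonneg_right (hbound k j w hw0) (by positivity)
                · rw [hC k hk j hj w ⟨hr.1.trans hw.1, hw.2.trans hzu.le⟩, zero_mul]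
                  positivity
            _ = n * M' * (2 * η') := by simp [mul_assoc]
        rw [intervalIntegral.integral_const, smul_eq_mul] at hint
        linarith
    rw [inv_mul_lt_iff₀ hzr]
    nlinarith
  have hgron := le_gronwallBound_of_liminf_deriv_right_le (f' := fun _ => 0) (δ := m) (K := 0)
    (ε := 0) hfc hslope (Finset.sup'_le hne _ hm) (by simp) t ht
  rw [gronwallBound_ε0, zero_mul, Real.exp_zero, mul_one] at hgron
  exact (Finset.le_sup' (fun k => x t k) hi).trans hgron

/-- Minimum principle on an isolated set of agents. -/
theorem IsTrajectory.ge_of_isolatedOn (hx : IsTrajectory a x) (ha : IsWeightFamily a)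
    (hbound : ∀ i j, ∀ t : ℝ, 0 ≤ t → a i j t ≤ M') {C : Finset (Fin n)} {s u m : ℝ}
    (hs : 0 ≤ s) (hC : IsolatedOn a C s u) (hm : ∀ i ∈ C, m ≤ x s i) {t : ℝ}
    (ht : t ∈ Icc s u) {i : Fin n} (hi : i ∈ C) : m ≤ x t i :=
  neg_le_neg_iff.1 (hx.neg.le_of_isolatedOn ha hbound hs hC
    (fun k hk => neg_le_neg (hm k hk)) ht hi)

/-- A continuous function with `z' ≥ -L z` in the integral sense decays at most exponentially. -/
theorem exp_neg_mul_le_of_integral_le {z : ℝ → ℝ} {L s u : ℝ} (hsu : s ≤ u)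
    (hz : ContinuousOn z (Icc s u))
    (hle : ∀ r ∈ Icc s u, ∀ t ∈ Icc r u, ∫ w in r..t, -(L * z w) ≤ z t - z r) :
    Real.exp (-(L * (u - s))) * z s ≤ z u := by
  have hslope : ∀ r ∈ Ico s u, ∀ η : ℝ, L * z r < η →
      ∃ᶠ t in 𝓝[>] r, (t - r)⁻¹ * ((fun t => -z t) t - (fun t => -z t) r) < η := by
    intro r hr η hη
    obtain ⟨η', hη'1, hη'2⟩ := exists_between hη
    have hcz : Tendsto (fun t => L * z t) (𝓝[≥] r) (𝓝 (L * z r)) :=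
      ((hz r ⟨hr.1, hr.2.le⟩).mono_of_mem_nhdsWithin
        (mem_of_superset (Icc_mem_nhdsGE hr.2) (Icc_subset_Icc_left hr.1))).const_mul L
    have hev : ∀ᶠ t in 𝓝[≥] r, t < u ∧ L * z t < η' :=
      ((eventually_lt_nhds hr.2).filter_mono nhdsWithin_le_nhds).and
        (hcz.eventually (gt_mem_nhds hη'1))
    obtain ⟨b, hb, hsub⟩ := (mem_nhdsGE_iff_exists_Icc_subset).1 hev
    refine Eventually.frequently ?_
    filter_upwards [Ioo_mem_nhdsGT (show r < b from hb)] with t ht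
    have htr : 0 < t - r := sub_pos.2 ht.1
    have htu : t < u := (hsub ⟨ht.1.le, ht.2.le⟩).1
    have hint : ∫ _ in r..t, -η' ≤ ∫ w in r..t, -(L * z w) := by
      refine intervalIntegral.integral_mono_on ht.1.le intervalIntegrable_const ?_ fun w hw => ?_
      · refine ContinuousOn.intervalIntegrable ?_
        rw [uIcc_of_le ht.1.le]
        exact ((hz.mono (Icc_subset_Icc hr.1 htu.le)).const_mul L).neg
      · exact neg_le_neg (hsub ⟨hw.1, hw.2.trans ht.2.le⟩).2.le
    rw [intervalIntegral.integral_const, smul_eq_mul] at hint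
    have := hle r ⟨hr.1, hr.2.le⟩ t ⟨ht.1.le, htu.le⟩
    rw [inv_mul_lt_iff₀ htr]
    have : (t - r) * η' < (t - r) * η := mul_lt_mul_of_pos_left hη'2 htr
    linarith
  have hgron := le_gronwallBound_of_liminf_deriv_right_le (f := fun t => -z t)
    (f' := fun t => L * z t) (δ := -z s) (K := -L) (ε := 0) hz.neg hslope le_rfl
    (fun r _ => by simp) u ⟨hsu, le_rfl⟩
  rw [gronwallBound_ε0] at hgron
  rw [show -(L * (u - s)) = -L * (u - s) by ring]
  linarith

/-- Measured from the level `m`, all agents of `C` pull `i` upwards, `j` by at least `c * a i j r`,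
while the loss is at most `M'` times the excess of `i` for each of the `n` indices. -/
theorem IsTrajectory.neg_mul_le_integrand (ha : IsWeightFamily a)
    (hbound : ∀ i j, ∀ t : ℝ, 0 ≤ t → a i j t ≤ M') {C : Finset (Fin n)} {m r : ℝ}
    (hr : 0 ≤ r) (hC : ∀ i ∈ C, ∀ j ∉ C, a i j r = 0) (hm : ∀ i ∈ C, m ≤ x r i)
    {i j : Fin n} (hi : i ∈ C) (hj : j ∈ C) {c : ℝ} (hc : c ≤ x r j - m) :
    c * a i j r - n * M' * (x r i - m) ≤ ∑ k, a i k r * (x r k - x r i) := by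
  have hM : 0 ≤ M' := (ha.nonneg i i 0 le_rfl).trans (hbound i i 0 le_rfl)
  have hi0 : 0 ≤ x r i - m := sub_nonneg.2 (hm i hi)
  calc c * a i j r - n * M' * (x r i - m)
      = ∑ k, ((if k = j then c * a i j r else 0) - M' * (x r i - m)) := by
        rw [Finset.sum_sub_distrib]; simp [mul_assoc]
    _ ≤ _ := by
      refine Finset.sum_le_sum fun k _ => ?_
      have hak := ha.nonneg i k r hr
      have hdec : a i k r * (x r i - m) ≤ M' * (x r i - m) :=
        mul_le_mul_of_nonneg_right (hbound i k r hr) hi0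
      by_cases hk : k ∈ C
      · have hgain : (if k = j then c * a i j r else 0) ≤ a i k r * (x r k - m) := by
          split_ifs with hkj
          · subst hkj
            rw [mul_comm]
            exact mul_le_mul_of_nonneg_left hc hak
          · exact mul_nonneg hak (sub_nonneg.2 (hm k hk))
        linarith
      · have hkj : k ≠ j := fun e => hk (e ▸ hj)
        rw [hC i hi k hk, if_neg hkj]
        have := mul_nonneg hM hi0
        linarith

/-- In an isolated set of agents above the level `m`, each excess over `m` decays at most
exponentially. -/
theorem IsTrajectory.exp_mul_le_of_isolatedOn (hx : IsTrajectory a x) (ha : IsWeightFamily a)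
    (hbound : ∀ i j, ∀ t : ℝ, 0 ≤ t → a i j t ≤ M') {C : Finset (Fin n)} {s u m : ℝ}
    (hs : 0 ≤ s) (hsu : s ≤ u) (hC : IsolatedOn a C s u) (hm : ∀ i ∈ C, m ≤ x s i)
    {i : Fin n} (hi : i ∈ C) :
    Real.exp (-(n * M' * (u - s))) * (x s i - m) ≤ x u i - m := by
  refine exp_neg_mul_le_of_integral_le (z := fun t => x t i - m) hsu
    ((hx.continuousOn i hs).sub continuousOn_const) fun r hr t ht => ?_
  have hcont : ContinuousOn (fun w => -(n * M' * (x w i - m))) (Icc r t) :=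
    (((hx.continuousOn i (hs.trans hr.1)).sub continuousOn_const).const_mul _).neg
  have := hx.integral_le_sub (i := i) (hs.trans hr.1) ht.1
    (f := fun w => -(n * M' * (x w i - m)))
    (ContinuousOn.intervalIntegrable (by rwa [uIcc_of_le ht.1])) fun w hw => by
      have hws : w ∈ Icc s u := ⟨hr.1.trans hw.1, hw.2.trans ht.2⟩
      have hmw : ∀ k ∈ C, m ≤ x w k := fun k hk => hx.ge_of_isolatedOn ha hbound hs hC hm hws hk
      have := IsTrajectory.neg_mul_le_integrand (x := x) ha hbound (hs.trans hws.1)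
        (fun i hi j hj => hC i hi j hj w hws) hmw hi hi (sub_nonneg.2 (hmw i hi))
      linarith
  simpa using this

/-- The fraction of an excess that is retained and transmitted over a step. -/
noncomputable def transmission (L ε B : ℝ) : ℝ :=
  Real.exp (-(L * B)) * (Real.exp (-(L * B)) * min 1 (ε / (1 + L * B)))

theorem transmission_pos {L ε B : ℝ} (hL : 0 ≤ L) (hB : 0 ≤ B) (hε : 0 < ε) :
    0 < transmission L ε B := by
  unfold transmission; positivity

theorem transmission_le_exp {L ε B : ℝ} (hL : 0 ≤ L) (hB : 0 ≤ B) :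
    transmission L ε B ≤ Real.exp (-(L * B)) := by
  refine mul_le_of_le_one_right (Real.exp_pos _).le ?_
  have h1 : Real.exp (-(L * B)) ≤ 1 := Real.exp_le_one_iff.2 (neg_nonpos.2 (by positivity))
  calc Real.exp (-(L * B)) * min 1 (ε / (1 + L * B)) ≤ Real.exp (-(L * B)) * 1 :=
        mul_le_mul_of_nonneg_left (min_le_left _ _) (Real.exp_pos _).le
    _ ≤ 1 := by rwa [mul_one]

theorem transmission_le_one {L ε B : ℝ} (hL : 0 ≤ L) (hB : 0 ≤ B) : transmission L ε B ≤ 1 :=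
  (transmission_le_exp hL hB).trans (Real.exp_le_one_iff.2 (neg_nonpos.2 (by positivity)))

theorem IsTrajectory.transmission_mul_le_self (hx : IsTrajectory a x) (ha : IsWeightFamily a)
    (hbound : ∀ i j, ∀ t : ℝ, 0 ≤ t → a i j t ≤ M') {C : Finset (Fin n)} {s u m d ε B : ℝ}
    (hs : 0 ≤ s) (hsu : s ≤ u) (hB : u - s ≤ B) (hC : IsolatedOn a C s u)
    (hm : ∀ i ∈ C, m ≤ x s i) {i : Fin n} (hi : i ∈ C) (hd : 0 ≤ d) (hid : d ≤ x s i - m) :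
    transmission (n * M') ε B * d ≤ x u i - m := by
  have hM : 0 ≤ M' := (ha.nonneg i i 0 le_rfl).trans (hbound i i 0 le_rfl)
  have hB0 : 0 ≤ B := (sub_nonneg.2 hsu).trans hB
  refine le_trans ?_ (hx.exp_mul_le_of_isolatedOn ha hbound hs hsu hC hm hi)
  refine mul_le_mul ((transmission_le_exp (by positivity) hB0).trans ?_) hid hd
    (Real.exp_pos _).le
  gcongr

/-- An excess is transmitted along a pair whose integral weight over the step is at least `ε`. -/
theorem IsTrajectory.transmission_mul_le (hx : IsTrajectory a x) (ha : IsWeightFamily a)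
    (hbound : ∀ i j, ∀ t : ℝ, 0 ≤ t → a i j t ≤ M') {C : Finset (Fin n)} {s u m d ε B : ℝ}
    (hε : 0 < ε)
    (hs : 0 ≤ s) (hsu : s ≤ u) (hB : u - s ≤ B) (hC : IsolatedOn a C s u)
    (hm : ∀ i ∈ C, m ≤ x s i) {i j : Fin n} (hi : i ∈ C) (hj : j ∈ C) (hd : 0 ≤ d)
    (hjd : d ≤ x s j - m) (hint : ε ≤ ∫ r in s..u, a i j r) :
    transmission (n * M') ε B * d ≤ x u i - m := by
  have hM : 0 ≤ M' := (ha.nonneg i i 0 le_rfl).trans (hbound i i 0 le_rfl)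
  have hB0 : 0 ≤ B := (sub_nonneg.2 hsu).trans hB
  obtain ⟨L, hL⟩ : ∃ L : ℝ, L = n * M' := ⟨_, rfl⟩
  have hL0 : 0 ≤ L := hL ▸ by positivity
  rw [← hL]
  have hmC : ∀ w ∈ Icc s u, ∀ k ∈ C, m ≤ x w k :=
    fun w hw k hk => hx.ge_of_isolatedOn ha hbound hs hC hm hw hk
  obtain ⟨c, hc⟩ : ∃ c : ℝ, c = Real.exp (-(L * B)) * d := ⟨_, rfl⟩
  have hc0 : 0 ≤ c := hc ▸ by positivity
  have hcj : ∀ w ∈ Icc s u, c ≤ x w j - m := by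
    intro w hw
    refine le_trans ?_ (hx.exp_mul_le_of_isolatedOn ha hbound hs hw.1
      (hC.mono le_rfl hw.2) hm hj)
    rw [hc, ← hL]
    refine mul_le_mul (Real.exp_le_exp.2 (neg_le_neg ?_)) hjd hd (Real.exp_pos _).le
    exact mul_le_mul_of_nonneg_left (by linarith [hw.2]) hL0
  -- The level `κ` satisfies `ε - L * B * κ ≥ κ`: what `j` supplies covers the loss and still leaves
  -- `κ`. The minimum with `1` keeps the transmitted fraction at most `1`.
  obtain ⟨κ, hκ⟩ : ∃ κ : ℝ, κ = min 1 (ε / (1 + L * B)) := ⟨_, rfl⟩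
  have hκ0 : 0 ≤ κ := hκ ▸ by positivity
  have hκε : κ * (1 + L * B) ≤ ε := by
    rw [← le_div_iff₀ (by positivity), hκ]; exact min_le_right _ _
  -- the excess of `i` reaches `κ * c` at some time of the step
  obtain ⟨t, ht, hti⟩ : ∃ t ∈ Icc s u, κ * c ≤ x t i - m := by
    -- While the excess of `i` is below `κ * c`, its drift is at least `c * a i j w - L * (κ * c)`.
    -- Integrated over the step this gives a gain of at least `κ * c`, a contradiction at time `u`.
    by_contra! hlt
    have hai := ha.intervalIntegrable i j hs (hs.trans hsu)
    have hle := hx.integral_le_sub (i := i) hs hsu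
      (f := fun w => c * a i j w - L * (κ * c))
      ((hai.const_mul c).sub intervalIntegrable_const) fun w hw => by
        have h1 := IsTrajectory.neg_mul_le_integrand (x := x) ha hbound (hs.trans hw.1)
          (fun i hi j hj => hC i hi j hj w hw) (hmC w hw) hi hj (hcj w hw)
        rw [← hL] at h1
        have h2 := mul_le_mul_of_nonneg_left (hlt w hw).le hL0
        linarith
    rw [intervalIntegral.integral_sub (hai.const_mul c) intervalIntegrable_const,
      intervalIntegral.integral_const_mul, intervalIntegral.integral_const, smul_eq_mul] at hle
    have h1 : c * (κ * (1 + L * B)) ≤ c * ∫ r in s..u, a i j r :=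
      mul_le_mul_of_nonneg_left (hκε.trans hint) hc0
    have h2 : (u - s) * (L * (κ * c)) ≤ B * (L * (κ * c)) :=
      mul_le_mul_of_nonneg_right hB (by positivity)
    have h3 := hlt u ⟨hsu, le_rfl⟩
    have h4 := hm i hi
    nlinarith
  have hdec := hx.exp_mul_le_of_isolatedOn ha hbound (hs.trans ht.1) ht.2
    (hC.mono ht.1 le_rfl) (hmC t ht) hi
  rw [← hL] at hdec
  refine le_trans ?_ hdec
  calc transmission L ε B * d = Real.exp (-(L * B)) * (κ * c) := by
        rw [transmission, hκ, hc]; ring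
    _ ≤ Real.exp (-(L * (u - t))) * (x t i - m) := by
        refine mul_le_mul (Real.exp_le_exp.2 (neg_le_neg ?_)) hti (by positivity)
          (Real.exp_pos _).le
        exact mul_le_mul_of_nonneg_left (by linarith [ht.1]) hL0

end Trajectory

/-! ### Consensus within the components of the persistent graph. -/

section Consensus

variable {n : ℕ} {a : Fin n → Fin n → ℝ → ℝ} {x : ℝ → Fin n → ℝ} {M' ε B : ℝ} {τ : ℕ → ℝ}

/-- From step `P` on, `C` receives no influence from outside, and every proper non-empty part of
`C` interacts again and again with the rest of `C`. -/
structure IsRecurrentClass (a : Fin n → Fin n → ℝ → ℝ) (τ : ℕ → ℝ) (C : Finset (Fin n))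
    (P : ℕ) : Prop where
  eq_zero : ∀ i ∈ C, ∀ j ∉ C, ∀ r, τ P ≤ r → a i j r = 0
  frequently : ∀ S ⊆ C, S.Nonempty → S ≠ C → ∃ i ∈ C \ S, ∃ j ∈ S,
    ∃ᶠ p in atTop, ActiveOnStep a τ i j p

theorem IsBalancedPartition.step_bound_nonneg (h : IsBalancedPartition a ε B τ) : 0 ≤ B :=
  (sub_nonneg.2 (h.le_succ 0)).trans (h.step_le 0)

namespace IsRecurrentClass

variable {C : Finset (Fin n)} {P : ℕ}

theorem isolatedOn (hC : IsRecurrentClass a τ C P) {s u : ℝ} (hs : τ P ≤ s) :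
    IsolatedOn a C s u :=
  fun i hi j hj r hr => hC.eq_zero i hi j hj r (hs.trans hr.1)

/-- A set of agents with large excess gains a new member after finitely many steps. -/
theorem exists_insert (hC : IsRecurrentClass a τ C P) (h : IsBalancedPartition a ε B τ)
    (hx : IsTrajectory a x) (ha : IsWeightFamily a)
    (hbound : ∀ i j, ∀ t : ℝ, 0 ≤ t → a i j t ≤ M') (hε : 0 < ε) {p : ℕ} (hp : P ≤ p)
    {m d : ℝ} (hd : 0 ≤ d) (hm : ∀ i ∈ C, m ≤ x (τ p) i) {S : Finset (Fin n)} (hSC : S ⊆ C)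
    (hS : S.Nonempty) (hne : S ≠ C) (hSd : ∀ i ∈ S, d ≤ x (τ p) i - m) :
    ∃ q, p ≤ q ∧ ∃ i ∈ C \ S, ∀ k ∈ insert i S,
      transmission (n * M') ε B * d ≤ x (τ q) k - m := by
  classical
  -- `Nat.find` selects the first step on which `S` interacts with the rest of `C`.
  have hex : ∃ q, p ≤ q ∧ ∃ i ∈ C \ S, ∃ j ∈ S, ActiveOnStep a τ i j q := by
    obtain ⟨i, hi, j, hj, hf⟩ := hC.frequently S hSC hS hne
    obtain ⟨q, hq, hact⟩ := (hf.and_eventually (eventually_ge_atTop p)).exists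
    exact ⟨q, hact, i, hi, j, hj, hq⟩
  obtain ⟨hpq, i, hi, j, hj, hact⟩ := Nat.find_spec hex
  have hmin : ∀ q < Nat.find hex, p ≤ q → ∀ i ∈ C \ S, ∀ j ∈ S, ¬ ActiveOnStep a τ i j q :=
    fun q hq hpq i hi j hj hact => Nat.find_min hex hq ⟨hpq, i, hi, j, hj, hact⟩
  generalize Nat.find hex = q at hpq hact hmin
  have hpP : τ P ≤ τ p := h.strictMono.monotone hp
  have hpq' : τ p ≤ τ q := h.strictMono.monotone hpq
  -- Before step `q` the set `S` is itself isolated, so the minimum principle on `S` preserves the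
  -- excess `d` without any loss, whatever the waiting time.
  have hkeep : ∀ q', p ≤ q' → q' ≤ q → ∀ k ∈ S, d + m ≤ x (τ q') k := by
    intro q' hpq'
    induction q', hpq' using Nat.le_induction with
    | base => exact fun _ k hk => by linarith [hSd k hk]
    | succ q' hq' ih =>
      intro hlt k hk
      refine hx.ge_of_isolatedOn ha hbound (h.nonneg q') (C := S) (u := τ (q' + 1)) ?_
        (ih (by omega)) ⟨h.le_succ q', le_rfl⟩ hk
      intro i hi j hj r hr
      by_cases hjC : j ∈ C
      · exact h.eq_zero_of_not_active ha (fun hact => hmin q' (by omega) hq' j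
          (Finset.mem_sdiff.2 ⟨hjC, hj⟩) i hi (ActiveOnStep.symm hact)) hr
      · exact hC.eq_zero i (hSC hi) j hjC r
          ((hpP.trans (h.strictMono.monotone hq')).trans hr.1)
  have hmq : ∀ k ∈ C, m ≤ x (τ q) k := fun k hk =>
    hx.ge_of_isolatedOn ha hbound (h.nonneg p) (hC.isolatedOn hpP (u := τ q)) hm
      ⟨hpq', le_rfl⟩ hk
  have hiso : IsolatedOn a C (τ q) (τ (q + 1)) := hC.isolatedOn (hpP.trans hpq')
  have hSq : ∀ k ∈ S, d ≤ x (τ q) k - m := fun k hk => by linarith [hkeep q hpq le_rfl k hk]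
  have hij : i ≠ j := fun e => (Finset.mem_sdiff.1 hi).2 (e ▸ hj)
  refine ⟨q + 1, by omega, i, hi, fun k hk => ?_⟩
  rcases Finset.mem_insert.1 hk with rfl | hkS
  · exact hx.transmission_mul_le ha hbound hε (h.nonneg q) (h.le_succ q) (h.step_le q) hiso hmq
      (Finset.mem_sdiff.1 hi).1 (hSC hj) hd (hSq j hj) (h.dichotomy k j hij q hact).1
  · exact hx.transmission_mul_le_self ha hbound (h.nonneg q) (h.le_succ q) (h.step_le q) hiso hmq
      (hSC hkS) hd (hSq k hkS)

/-- The excess of a single agent is transmitted to the whole class after finitely many steps. -/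
theorem exists_forall_le (hC : IsRecurrentClass a τ C P) (h : IsBalancedPartition a ε B τ)
    (hx : IsTrajectory a x) (ha : IsWeightFamily a)
    (hbound : ∀ i j, ∀ t : ℝ, 0 ≤ t → a i j t ≤ M') (hε : 0 < ε) (hM : 0 ≤ M') {N : ℕ}
    {p : ℕ} (hp : P ≤ p)
    {m d : ℝ} (hd : 0 ≤ d) (hm : ∀ i ∈ C, m ≤ x (τ p) i) {S : Finset (Fin n)} (hSC : S ⊆ C)
    (hS : S.Nonempty) (hN : C.card ≤ S.card + N) (hSd : ∀ i ∈ S, d ≤ x (τ p) i - m) :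
    ∃ q, p ≤ q ∧ ∀ k ∈ C, transmission (n * M') ε B ^ N * d ≤ x (τ q) k - m := by
  classical
  have hδ := transmission_pos (L := n * M') (by positivity) h.step_bound_nonneg hε
  have hδ1 := transmission_le_one (L := n * M') (ε := ε) (by positivity) h.step_bound_nonneg
  induction N generalizing p d S with
  | zero =>
    have hSeq : S = C := Finset.eq_of_subset_of_card_le hSC (by simpa using hN)
    exact ⟨p, le_rfl, by simpa [← hSeq] using hSd⟩
  | succ N ih =>
    by_cases hSeq : S = C
    · refine ⟨p, le_rfl, fun k hk => le_trans ?_ (hSd k (hSeq ▸ hk))⟩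
      exact mul_le_of_le_one_left hd (pow_le_one₀ hδ.le hδ1)
    · obtain ⟨q, hpq, i, hi, hq⟩ :=
        hC.exists_insert h hx ha hbound hε hp hd hm hSC hS hSeq hSd
      have hi' := Finset.mem_sdiff.1 hi
      obtain ⟨q', hqq', hq'⟩ := ih (hp.trans hpq) (d := transmission (n * M') ε B * d)
        (by positivity)
        (fun k hk => hx.ge_of_isolatedOn ha hbound (h.nonneg p)
          (hC.isolatedOn (h.strictMono.monotone hp) (u := τ q)) hm
          ⟨h.strictMono.monotone hpq, le_rfl⟩ hk)
        (S := insert i S) (Finset.insert_subset hi'.1 hSC) (Finset.insert_nonempty _ _)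
        (by rw [Finset.card_insert_of_notMem hi'.2]; omega) hq
      refine ⟨q', hpq.trans hqq', fun k hk => ?_⟩
      rw [pow_succ, mul_assoc]
      exact hq' k hk

/-- The agents of a recurrent class reach consensus. -/
theorem exists_tendsto (hC : IsRecurrentClass a τ C P) (hne : C.Nonempty)
    (h : IsBalancedPartition a ε B τ) (hx : IsTrajectory a x) (ha : IsWeightFamily a)
    (hbound : ∀ i j, ∀ t : ℝ, 0 ≤ t → a i j t ≤ M') (hε : 0 < ε) :
    ∃ c : ℝ, ∀ i ∈ C, Tendsto (fun t => x t i) atTop (𝓝 c) := by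
  have hM : 0 ≤ M' := by
    obtain ⟨i, -⟩ := hne
    exact (ha.nonneg i i 0 le_rfl).trans (hbound i i 0 le_rfl)
  have hmono : ∀ s t, τ P ≤ s → s ≤ t →
      (C.inf' hne fun i => x s i) ≤ C.inf' hne fun i => x t i := by
    intro s t hs hst
    exact Finset.le_inf' hne _ fun i hi => hx.ge_of_isolatedOn ha hbound ((h.nonneg P).trans hs)
      (hC.isolatedOn hs (u := t)) (fun k hk => Finset.inf'_le _ hk) ⟨hst, le_rfl⟩ hi
  have hanti : ∀ s t, τ P ≤ s → s ≤ t →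
      (C.sup' hne fun i => x t i) ≤ C.sup' hne fun i => x s i := by
    intro s t hs hst
    exact Finset.sup'_le hne _ fun i hi => hx.le_of_isolatedOn ha hbound ((h.nonneg P).trans hs)
      (hC.isolatedOn hs (u := t)) (fun k hk => Finset.le_sup' (fun i => x s i) hk)
      ⟨hst, le_rfl⟩ hi
  have hle : ∀ t, (C.inf' hne fun i => x t i) ≤ C.sup' hne fun i => x t i :=
    fun t =>
    (Finset.inf'_le _ hne.choose_spec).trans (Finset.le_sup' (fun i => x t i) hne.choose_spec)
  obtain ⟨lo, hlo⟩ : ∃ lo, Tendsto (fun t => C.inf' hne fun i => x t i) atTop (𝓝 lo) ∧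
      ∀ t, τ P ≤ t → (C.inf' hne fun i => x t i) ≤ lo := by
    -- Monotonicity holds only from `τ P` on; clamping time there makes it global.
    have hm : Monotone fun t => C.inf' hne fun i => x (max t (τ P)) i :=
      fun s t hst => hmono _ _ (le_max_right _ _) (max_le_max_right _ hst)
    have hb : BddAbove (range fun t => C.inf' hne fun i => x (max t (τ P)) i) :=
      ⟨C.sup' hne fun i => x (τ P) i, by
        rintro _ ⟨t, rfl⟩
        exact (hle _).trans (hanti _ _ le_rfl (le_max_right _ _))⟩
    refine ⟨_, (tendsto_atTop_ciSup hm hb).congr' ?_, fun t ht => ?_⟩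
    · filter_upwards [eventually_ge_atTop (τ P)] with t ht
      rw [max_eq_left ht]
    · simpa [max_eq_left ht] using le_ciSup hb t
  obtain ⟨hi, hhi⟩ : ∃ hi, Tendsto (fun t => C.sup' hne fun i => x t i) atTop (𝓝 hi) ∧
      ∀ t, τ P ≤ t → hi ≤ C.sup' hne fun i => x t i := by
    have hm : Antitone fun t => C.sup' hne fun i => x (max t (τ P)) i :=
      fun s t hst => hanti _ _ (le_max_right _ _) (max_le_max_right _ hst)
    have hb : BddBelow (range fun t => C.sup' hne fun i => x (max t (τ P)) i) :=
      ⟨C.inf' hne fun i => x (τ P) i, by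
        rintro _ ⟨t, rfl⟩
        exact (hmono _ _ le_rfl (le_max_right _ _)).trans (hle _)⟩
    refine ⟨_, (tendsto_atTop_ciInf hm hb).congr' ?_, fun t ht => ?_⟩
    · filter_upwards [eventually_ge_atTop (τ P)] with t ht
      rw [max_eq_left ht]
    · simpa [max_eq_left ht] using ciInf_le hb t
  have hlohi : hi ≤ lo := by
    by_contra! hlt
    have hδ := transmission_pos (L := n * M') (by positivity) h.step_bound_nonneg hε
    have hg : 0 < transmission (n * M') ε B ^ C.card * (hi - lo) :=
      mul_pos (pow_pos hδ _) (sub_pos.2 hlt)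
    -- Take `p` so late that the minimum is within the transmitted amount of `lo`. The agent at the
    -- maximum has excess at least `hi - lo`, and spreading it lifts the minimum above `lo`.
    have hev := (hlo.1.comp h.tendsto).eventually (lt_mem_nhds (sub_lt_self lo hg))
    obtain ⟨p, hp, hPp⟩ := (hev.and (eventually_ge_atTop P)).exists
    have hPτ : τ P ≤ τ p := h.strictMono.monotone hPp
    obtain ⟨i, hiC, hi_eq⟩ := Finset.exists_mem_eq_sup' hne fun i => x (τ p) i
    obtain ⟨q, hpq, hq⟩ := hC.exists_forall_le h hx ha hbound hε hM (N := C.card) hPp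
      (m := C.inf' hne fun i => x (τ p) i) (d := hi - lo) (sub_pos.2 hlt).le
      (fun k hk => Finset.inf'_le _ hk) (S := {i}) (by simpa using hiC)
      (Finset.singleton_nonempty i) (by simp) (fun k hk => by
        rw [Finset.mem_singleton] at hk
        subst hk
        rw [← hi_eq]
        exact sub_le_sub (hhi.2 _ hPτ) (hlo.2 _ hPτ))
    obtain ⟨k, hkC, hk_eq⟩ := Finset.exists_mem_eq_inf' hne fun i => x (τ q) i
    have h1 := hq k hkC
    have h2 := hlo.2 (τ q) (hPτ.trans (h.strictMono.monotone hpq))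
    rw [hk_eq] at h2
    simp only [Function.comp_apply] at hp
    linarith
  have hlim : lo = hi := le_antisymm (le_of_tendsto_of_tendsto' hlo.1 hhi.1 hle) hlohi
  refine ⟨lo, fun i hi => ?_⟩
  exact tendsto_of_tendsto_of_tendsto_of_le_of_le hlo.1 (hlim ▸ hhi.1)
    (fun t => Finset.inf'_le _ hi) (fun t => Finset.le_sup' (fun i => x t i) hi)

end IsRecurrentClass

/-- The class is the component of `i`. The finitely many pairs without an edge all fall silent after
a common step, which isolates it; a proper non-empty part with no recurrent interaction would be
closed under edges, against connectedness. -/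
theorem IsBalancedPartition.exists_isRecurrentClass (h : IsBalancedPartition a ε B τ)
    (ha : IsWeightFamily a) (hε : 0 < ε) (i : Fin n) :
    ∃ C : Finset (Fin n), (∀ j, j ∈ C ↔ PersistentPath a i j) ∧ ∃ P, IsRecurrentClass a τ C P := by
  classical
  have hmem : ∀ j, j ∈ Finset.univ.filter (PersistentPath a i) ↔ PersistentPath a i j := by simp
  refine ⟨Finset.univ.filter (PersistentPath a i), hmem, ?_⟩
  have hev : ∀ᶠ P in atTop, ∀ k l, k ≠ l → ¬ (persistentGraph a).Adj l k →
      ∀ p, P ≤ p → ¬ ActiveOnStep a τ k l p := by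
    refine eventually_all.2 fun k => eventually_all.2 fun l => ?_
    by_cases hkl : k ≠ l ∧ ¬ (persistentGraph a).Adj l k
    · have hnf : ∀ᶠ p in atTop, ¬ ActiveOnStep a τ k l p := by
        by_contra hcon
        exact hkl.2 (h.persistent_of_frequently_active ha hε hkl.1 (not_eventually.1 hcon |>.mono
          fun _ => not_not.1))
      obtain ⟨P, hP⟩ := eventually_atTop.1 hnf
      filter_upwards [eventually_ge_atTop P] with Q hQ _ _ p hp using hP p (hQ.trans hp)
    · exact Eventually.of_forall fun _ h1 h2 => absurd ⟨h1, h2⟩ hkl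
  obtain ⟨P, hP⟩ := hev.exists
  refine ⟨P, fun k hk l hl r hr => ?_, fun S hSC hS hne => ?_⟩
  · have hkl : k ≠ l := fun e => hl (e ▸ hk)
    refine h.eq_zero_of_forall_not_active ha (hP k l hkl fun hadj => hl ?_) hr
    rw [hmem] at hk ⊢
    exact Relation.ReflTransGen.tail hk (h.persistentGraph_symm ha hε hadj)
  · by_contra! hcon
    have hclosed : ∀ j ∈ S, ∀ k, (persistentGraph a).Adj j k → k ∈ S := by
      intro j hj k hjk
      by_contra hkS
      refine h.frequently_active_of_persistent ha hjk
        (hcon k (Finset.mem_sdiff.2 ⟨?_, hkS⟩) j hj)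
      have hij := (hmem j).1 (hSC hj)
      exact (hmem k).2 (Relation.ReflTransGen.tail hij hjk)
    obtain ⟨j, hj⟩ := hS
    refine hne (Finset.Subset.antisymm hSC fun k hk => ?_)
    have hjk : PersistentPath a j k :=
      Relation.ReflTransGen.trans (h.persistentPath_symm ha hε ((hmem j).1 (hSC hj)))
        ((hmem k).1 hk)
    unfold PersistentPath at hjk
    induction hjk with
    | refl => exact hj
    | tail hpath hadj ih =>
      exact hclosed _ (ih ((hmem _).2 (Relation.ReflTransGen.trans ((hmem j).1 (hSC hj)) hpath)))
        _ hadj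

end Consensus

theorem theorem2 {n : ℕ} (a : Fin n → Fin n → ℝ → ℝ) (ha : IsWeightFamily a)
    (hrec : PairwiseReciprocity a)
    (M' : ℝ) (hbound : ∀ i j, ∀ t : ℝ, 0 ≤ t → a i j t ≤ M') :
    (∃ τ : ℕ → ℝ, τ 0 = 0 ∧ (∃ B : ℝ, ∀ k : ℕ, τ (k + 1) - τ k ≤ B) ∧
      IntegralReciprocity a τ ∧ IntegralBound a τ) ∧
    (∀ i j, PersistentPath a i j ↔ PersistentPath a j i) ∧
    (∀ x : ℝ → Fin n → ℝ, IsTrajectory a x →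
      ∃ xlim : Fin n → ℝ, (∀ i, Tendsto (fun t => x t i) atTop (𝓝 (xlim i))) ∧
        ∀ i j, PersistentPath a i j → xlim i = xlim j) := by
  obtain ⟨ε, T, hε, hT, hc⟩ := hrec.exists_compensatedWithin
  obtain ⟨B, τ, h⟩ := hc.exists_isBalancedPartition ha hT
  refine ⟨⟨τ, h.zero, ⟨B, h.step_le⟩, h.integralReciprocity ha hε hbound,
    h.integralBound ha hbound⟩,
    fun i j => ⟨h.persistentPath_symm ha hε, h.persistentPath_symm ha hε⟩, fun x hx => ?_⟩
  have hlim : ∀ i, ∃ c : ℝ, ∀ j, PersistentPath a i j →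
      Tendsto (fun t => x t j) atTop (𝓝 c) := by
    intro i
    obtain ⟨C, hmem, P, hC⟩ := h.exists_isRecurrentClass ha hε i
    obtain ⟨c, hc⟩ := hC.exists_tendsto ⟨i, (hmem i).2 Relation.ReflTransGen.refl⟩ h hx ha
      hbound hε
    exact ⟨c, fun j hj => hc j ((hmem j).2 hj)⟩
  choose xlim hxlim using hlim
  exact ⟨xlim, fun i => hxlim i i Relation.ReflTransGen.refl, fun i j hij =>
    tendsto_nhds_unique (hxlim i j hij) (hxlim j j Relation.ReflTransGen.refl)⟩
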